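/- Let $X,Y$ be Banach spaces over $\mathbb K\in\{\mathbb R,\mathbb C\}$ and let $A:X\to Y$ be a bounded linear operator. For an ultrafilter $\mathcal U$ on a set $I$, let $X_{\mathcal U}=\ell_\infty(I,X)/\{(x_i):\lim_{\mathcal U}\|x_i\|=0\}$ be the ultrapower of $X$, and let $A_{\mathcal U}:X_{\mathcal U}\to Y_{\mathcal U}$ be the operator induced by $(x_i)\mapsto(Ax_i)$. The operator $A$ is called super weakly compact if for every ultrafilter $\mathcal U$ the operator $A_{\mathcal U}$ is weakly compact, i.e. maps the closed unit ball to a relatively weakly compact set. A finite sequence $(y_i)_{i=1}^n$ in $Y$ is called $c$-basic if all $y_i$ are non-zero and $$\Big\|\sum_{i=1}^m a_iy_i\Big\|\leqslant c\,\Big\|\sum_{i=1}^n a_iy_i\Big\|\qquad\text{for all scalars } a_1,\dots,a_n \text{ and all } 0\leqslant m\leqslant n.$$ Suppose that $A$ is not super weakly compact. Then there exist constants $\psi>0$ and $c\geqslant 1$ such that for every $n\in\mathbb N$ and every linear subspace $Z\leqslant X$ (closed or not) with $\dim(X/Z)<\infty$ there exist $z_1,\dots,z_n\in Z$ with $\|z_i\|\leqslant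 1$ such that $(Az_i)_{i=1}^n$ is $c$-basic and $\big\|\sum_{i=1}^n a_iAz_i\big\|\geqslant\psi$ for all real $a_1,\dots,a_n\geqslant0$ with $\sum_{i=1}^n a_i=1$. -/

import Mathlib

open Filter Topology
open scoped ENNReal

universe t u v w

noncomputable section

namespace BanachUltrapower

section Spaces

variable {𝕜 : Type t} [RCLike 𝕜] {I : Type w}
variable (𝕜)

/-- For an ultrafilter `U` on `I`, the subspace of those bounded families `x : I → X`, that is,
elements of `ℓ∞(I, X)`, for which `lim_U ‖x i‖ = 0`. -/
def nullSubmodule (U : Ultrafilter I) (X : Type u) [NormedAddCommGroup X] [NormedSpace 𝕜 X] :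
    Submodule 𝕜 (lp (fun _ : I => X) ∞) where
  carrier := {x | Tendsto (fun i => ‖x i‖) (U : Filter I) (𝓝 0)}
  zero_mem' := by simp
  add_mem' := by
    intro x y hx hy
    have h : Tendsto (fun i => ‖x i‖ + ‖y i‖) (U : Filter I) (𝓝 (0 + 0)) := Tendsto.add hx hy
    rw [add_zero] at h
    exact squeeze_zero (fun i => norm_nonneg _) (fun i => norm_add_le (x i) (y i)) h
  smul_mem' := by
    intro c x hx
    have h : Tendsto (fun i => ‖c‖ * ‖x i‖) (U : Filter I) (𝓝 (‖c‖ * 0)) :=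
      Tendsto.const_mul _ hx
    simpa [norm_smul] using h

variable {𝕜} in
theorem mem_nullSubmodule {U : Ultrafilter I} {X : Type u} [NormedAddCommGroup X]
    [NormedSpace 𝕜 X] {x : lp (fun _ : I => X) ∞} :
    x ∈ nullSubmodule 𝕜 U X ↔ Tendsto (fun i => ‖x i‖) (U : Filter I) (𝓝 0) :=
  Iff.rfl

instance isClosed_nullSubmodule (U : Ultrafilter I) (X : Type u) [NormedAddCommGroup X]
    [NormedSpace 𝕜 X] : IsClosed (nullSubmodule 𝕜 U X : Set (lp (fun _ : I => X) ∞)) := by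
  rw [← closure_subset_iff_isClosed]
  intro x hx
  rw [Metric.mem_closure_iff] at hx
  change Tendsto (fun i => ‖x i‖) (U : Filter I) (𝓝 0)
  rw [Metric.tendsto_nhds]
  intro ε hε
  obtain ⟨y, hy, hxy⟩ := hx (ε / 2) (half_pos hε)
  have hy' : Tendsto (fun i => ‖y i‖) (U : Filter I) (𝓝 0) := hy
  rw [Metric.tendsto_nhds] at hy'
  filter_upwards [hy' (ε / 2) (half_pos hε)] with i hi
  have h1 : ‖x i - y i‖ ≤ ‖x - y‖ := by
    simpa using lp.norm_apply_le_norm ENNReal.top_ne_zero (x - y) i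
  rw [dist_eq_norm] at hxy
  simp only [dist_zero_right, norm_norm] at hi ⊢
  have h2 : ‖x i‖ ≤ ‖x i - y i‖ + ‖y i‖ := by
    simpa using norm_add_le (x i - y i) (y i)
  linarith

/-- The ultrapower `X_U = ℓ∞(I, X) / {x | lim_U ‖x i‖ = 0}` with the quotient norm. -/
abbrev Ultrapower (U : Ultrafilter I) (X : Type u) [NormedAddCommGroup X] [NormedSpace 𝕜 X] :
    Type (max u w) :=
  lp (fun _ : I => X) ∞ ⧸ nullSubmodule 𝕜 U X

end Spaces

section Operators

variable {𝕜 : Type t} [RCLike 𝕜] {I : Type w}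
  {X : Type u} [NormedAddCommGroup X] [NormedSpace 𝕜 X]
  {Y : Type v} [NormedAddCommGroup Y] [NormedSpace 𝕜 Y]

/-- The coordinatewise action `(x i) ↦ (A (x i))` of an operator `A : X → Y`, as an operator
`ℓ∞(I, X) → ℓ∞(I, Y)`. -/
def linftyMap (I : Type w) (A : X →L[𝕜] Y) :
    lp (fun _ : I => X) ∞ →L[𝕜] lp (fun _ : I => Y) ∞ :=
  lp.mapCLM ∞ (fun _ : I => A) (norm_nonneg A) (fun _ => le_rfl)

theorem linftyMap_apply (A : X →L[𝕜] Y) (x : lp (fun _ : I => X) ∞) (i : I) :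
    linftyMap I A x i = A (x i) := rfl

theorem linftyMap_mem_nullSubmodule {U : Ultrafilter I} (A : X →L[𝕜] Y)
    {x : lp (fun _ : I => X) ∞} (hx : x ∈ nullSubmodule 𝕜 U X) :
    linftyMap I A x ∈ nullSubmodule 𝕜 U Y := by
  change Tendsto (fun i => ‖A (x i)‖) (U : Filter I) (𝓝 0)
  have hx' : Tendsto (fun i => ‖x i‖) (U : Filter I) (𝓝 0) := hx
  refine squeeze_zero (fun i => norm_nonneg _) (fun i => A.le_opNorm (x i)) ?_
  simpa using hx'.const_mul ‖A‖

/-- The ultrapower `A_U : X_U → Y_U` of an operator, induced by `(x i) ↦ (A (x i))`. -/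
def ultrapowerMap (U : Ultrafilter I) (A : X →L[𝕜] Y) :
    Ultrapower 𝕜 U X →L[𝕜] Ultrapower 𝕜 U Y :=
  (nullSubmodule 𝕜 U X).liftQL ((nullSubmodule 𝕜 U Y).mkQL ∘L linftyMap I A) fun _ hx =>
    (Submodule.Quotient.mk_eq_zero _).2 (linftyMap_mem_nullSubmodule A hx)

theorem ultrapowerMap_mk (U : Ultrafilter I) (A : X →L[𝕜] Y) (x : lp (fun _ : I => X) ∞) :
    ultrapowerMap U A (Submodule.Quotient.mk x) = Submodule.Quotient.mk (linftyMap I A x) := rfl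

end Operators

end BanachUltrapower

/-- An operator is weakly compact if the image of the closed unit ball is relatively compact in
the weak topology. -/
def IsWeaklyCompactOperator {𝕜 : Type t} [RCLike 𝕜]
    {X : Type u} [NormedAddCommGroup X] [NormedSpace 𝕜 X]
    {Y : Type v} [NormedAddCommGroup Y] [NormedSpace 𝕜 Y] (A : X →L[𝕜] Y) : Prop :=
  IsCompact (closure (toWeakSpace 𝕜 Y '' (A '' Metric.closedBall (0 : X) 1)))

/-- An operator is super weakly compact if all its ultrapowers are weakly compact; the ultrafilters
range over all index sets `I` in the universe `w`. -/
def IsSuperWeaklyCompactOperator {𝕜 : Type t} [RCLike 𝕜]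
    {X : Type u} [NormedAddCommGroup X] [NormedSpace 𝕜 X]
    {Y : Type v} [NormedAddCommGroup Y] [NormedSpace 𝕜 Y] (A : X →L[𝕜] Y) : Prop :=
  ∀ (I : Type w) (U : Ultrafilter I),
    IsWeaklyCompactOperator (BanachUltrapower.ultrapowerMap U A)

/-- The finite sequence `y` is `c`-basic: its members are non-zero and its initial-segment
projections have norm at most `c` on its linear span. -/
def IsBasicWith (𝕜 : Type t) [RCLike 𝕜] {Y : Type v} [NormedAddCommGroup Y] [NormedSpace 𝕜 Y]
    (c : ℝ) {n : ℕ} (y : Fin n → Y) : Prop :=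
  (∀ i, y i ≠ 0) ∧
    ∀ (a : Fin n → 𝕜) (m : ℕ), ‖∑ i with i.val < m, a i • y i‖ ≤ c * ‖∑ i, a i • y i‖

end

set_option maxSynthPendingDepth 3

/-! Some ultrapower of `A` is not weakly compact, so images of its unit ball have a weak-star limit
`φ` in the bidual of `Y_U`, at distance `δ > 0` from `Y_U`. A Mazur-type selection
(`exists_isBasicWith_of_tendsto`) extracts long basic sequences from any family tending weak-star to
such a functional, with constants depending only on `δ` and a bound for the norm of the limit. To
reach `Z`, each image is translated by a diagonal vector `D (σ x)`, where `σ x` converges in norm to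
some `b` in `X`; finite codimension supplies `σ` by compactness (`exists_correction`). The limit
becomes `φ - J (D b)`, still at distance at least `δ` from `Y_U` and bounded independently of `Z`,
so the constants are uniform. Finally, norms of finite combinations in `Y_U` are limits of
coordinate norms, uniformly in normalised coefficients (`eventually_abs_norm_sum_sub_le`). A single
coordinate thus copies the basic sequence almost isometrically; it is then perturbed into `Z` and
rescaled. -/

noncomputable section

/-! ### Finite norming sets -/

section Norming

variable {𝕜 : Type t} [RCLike 𝕜] {F : Type v} [NormedAddCommGroup F] [NormedSpace 𝕜 F]

/-- A functional almost attains its norm at a vector of the closed unit ball. -/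
theorem exists_norm_le_one_lt_norm_apply (g : StrongDual 𝕜 F) {r : ℝ} (hr : r < ‖g‖) :
    ∃ f : F, ‖f‖ ≤ 1 ∧ r < ‖g f‖ := by
  by_contra! h
  rcases lt_or_ge r 0 with h0 | h0
  · have := h 0 (by simp)
    simp at this
    linarith
  · refine absurd hr (not_lt.2 (g.opNorm_le_of_unit_norm h0 fun f hf => h f hf.le))

/-- A finite-dimensional space of functionals is `2`-normed by finitely many vectors of the unit
ball. -/
theorem exists_finset_norming (G : Submodule 𝕜 (StrongDual 𝕜 F)) [FiniteDimensional 𝕜 G] :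
    ∃ Φ : Finset F, (∀ f ∈ Φ, ‖f‖ ≤ 1) ∧ ∀ g ∈ G, g ≠ 0 → ∃ f ∈ Φ, ‖g‖ ≤ 2 * ‖g f‖ := by
  classical
  have : ProperSpace G := FiniteDimensional.proper_rclike 𝕜 G
  have hc : IsCompact (Metric.sphere (0 : G) 1) := isCompact_sphere 0 1
  -- Each open set consists of the functionals of which one vector detects more than half the norm
  -- on the sphere.
  obtain ⟨s, hs⟩ := hc.elim_finite_subcover
    (fun f : Metric.closedBall (0 : F) 1 => {g : G | 1 < 2 * ‖(g : StrongDual 𝕜 F) f‖})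
    (fun f => by
      refine isOpen_lt continuous_const (continuous_const.mul (Continuous.norm ?_))
      exact ((ContinuousLinearMap.apply 𝕜 𝕜 (f : F)).continuous).comp continuous_subtype_val)
    (fun g hg => by
      have hg1 : ‖(g : StrongDual 𝕜 F)‖ = 1 := mem_sphere_zero_iff_norm.1 hg
      obtain ⟨f, hf, hgf⟩ :=
        exists_norm_le_one_lt_norm_apply (g : StrongDual 𝕜 F) (r := 1 / 2) (by rw [hg1]; norm_num)
      refine Set.mem_iUnion.2 ⟨⟨f, mem_closedBall_zero_iff.2 hf⟩, ?_⟩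
      simp only [Set.mem_ofPred_eq]
      linarith)
  refine ⟨s.image Subtype.val, ?_, ?_⟩
  · intro f hf
    obtain ⟨f', -, rfl⟩ := Finset.mem_image.1 hf
    exact mem_closedBall_zero_iff.1 f'.2
  · intro g hg hg0
    have hn : ‖g‖ ≠ 0 := norm_ne_zero_iff.2 hg0
    have hmem : (((‖g‖ : 𝕜)⁻¹) • (⟨g, hg⟩ : G)) ∈ Metric.sphere (0 : G) 1 := by
      rw [mem_sphere_zero_iff_norm, norm_smul, norm_inv, RCLike.norm_ofReal, abs_norm]
      exact inv_mul_cancel₀ hn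
    obtain ⟨f, hfs, hf⟩ := Set.mem_iUnion₂.1 (hs hmem)
    refine ⟨f, Finset.mem_image_of_mem _ hfs, ?_⟩
    simp only [Set.mem_ofPred_eq, Submodule.coe_smul, smul_apply,
      norm_smul, norm_inv, RCLike.norm_ofReal, abs_norm] at hf
    have hp : 0 < ‖g‖ := norm_pos_iff.2 hg0
    have h2 : 1 < (2 * ‖g (f : F)‖) / ‖g‖ := by
      rw [div_eq_inv_mul]; linarith
    rw [one_lt_div hp] at h2
    exact h2.le

end Norming

/-! ### Selection of basic sequences from a weak-star limit -/

section Basic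

variable {𝕜 : Type t} [RCLike 𝕜] {F : Type v} [NormedAddCommGroup F] [NormedSpace 𝕜 F]

theorem sum_filter_val_lt_succ {n : ℕ} (x : Fin n → F) (j : Fin n) :
    ∑ i with i.val < j.val + 1, x i = x j + ∑ i with i.val < j.val, x i := by
  have : (Finset.univ.filter fun i : Fin n => i.val < j.val + 1) =
      insert j (Finset.univ.filter fun i : Fin n => i.val < j.val) := by
    ext i
    simp only [Finset.mem_filter, Finset.mem_univ, true_and, Finset.mem_insert, Fin.ext_iff]
    omega
  rw [this, Finset.sum_insert (by simp)]

/-- Initial-segment projections that are bounded up to a small multiple of the `ℓ¹`-norm of the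
coefficients are bounded. -/
theorem isBasicWith_of_norm_le_add {n : ℕ} {y : Fin n → F} {C ε d : ℝ} (hC : 0 ≤ C) (hd : 0 < d)
    (hsmall : 4 * n * C * ε ≤ d) (hy : ∀ i, d ≤ ‖y i‖)
    (h : ∀ (a : Fin n → 𝕜) (m : ℕ),
      ‖∑ i with i.val < m, a i • y i‖ ≤ C * (‖∑ i, a i • y i‖ + ε * ∑ i, ‖a i‖)) :
    IsBasicWith 𝕜 (2 * C) y := by
  refine ⟨fun i => norm_pos_iff.1 (hd.trans_le (hy i)), fun a m => ?_⟩
  set S := ‖∑ i, a i • y i‖ with hS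
  set R := ∑ i, ‖a i‖ with hR
  have hS0 : 0 ≤ S := norm_nonneg _
  have hR0 : 0 ≤ R := Finset.sum_nonneg fun i _ => norm_nonneg _
  have h1 : ∀ i, d * ‖a i‖ ≤ 2 * (C * (S + ε * R)) := fun i => by
    have e := sum_filter_val_lt_succ (fun i => a i • y i) i
    have e' : a i • y i = (∑ k with k.val < i.val + 1, a k • y k) -
        ∑ k with k.val < i.val, a k • y k := by rw [e]; abel
    calc d * ‖a i‖ ≤ ‖y i‖ * ‖a i‖ := by gcongr; exact hy i
      _ = ‖a i • y i‖ := by rw [norm_smul, mul_comm]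
      _ ≤ ‖∑ k with k.val < i.val + 1, a k • y k‖ + ‖∑ k with k.val < i.val, a k • y k‖ := by
        rw [e']; exact norm_sub_le _ _
      _ ≤ _ := by linarith [h a (i.val + 1), h a i.val]
  have h2 : d * R ≤ n * (2 * (C * (S + ε * R))) := by
    rw [hR, Finset.mul_sum]
    refine (Finset.sum_le_sum fun i _ => h1 i).trans ?_
    simp [hR]
  -- Otherwise the right side of `h2` drops below `4 * n * C * ε * R ≤ d * R`. The `ℓ¹` error is
  -- therefore absorbed by doubling `C`.
  have h3 : ε * R ≤ S := by
    by_contra! h4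
    have h5 : d * R ≤ (4 * n * C * ε) * R := by
      refine h2.trans ?_
      have : (n : ℝ) * (2 * (C * (S + ε * R))) ≤ n * (2 * (C * (ε * R + ε * R))) := by gcongr
      refine this.trans (le_of_eq (by ring))
    have hRpos : 0 < R := by
      rcases hR0.eq_or_lt with h6 | h6
      · rw [← h6] at h4; simp at h4; linarith
      · exact h6
    have h7 : n * (2 * (C * (S + ε * R))) < d * R := by
      have hCn : 0 < (n : ℝ) * C := by
        have : 0 ≤ (n : ℝ) * C := by positivity
        rcases this.eq_or_lt with h8 | h8
        · have : (n : ℝ) * (2 * (C * (S + ε * R))) = 0 := by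
            linear_combination (-2 * (S + ε * R)) * h8
          have : 0 < d * R := by positivity
          linarith
        · exact h8
      nlinarith [mul_le_mul_of_nonneg_right hsmall hR0, mul_lt_mul_of_pos_left h4 hCn]
    linarith
  calc _ ≤ C * (S + ε * R) := h a m
    _ ≤ C * (S + S) := by gcongr
    _ = 2 * C * S := by ring

/-- If bounded vectors `y t` converge weak-star to a bidual functional `φ` at distance at least `δ`
from the space, then among them there are arbitrarily long uniformly basic sequences whose convex
combinations are bounded away from zero. -/
theorem exists_isBasicWith_of_tendsto {T : Type w} {l : Filter T} [NeBot l] {y : T → F}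
    {φ : StrongDual 𝕜 (StrongDual 𝕜 F)}
    (hφ : ∀ f : StrongDual 𝕜 F, Tendsto (fun t => f (y t)) l (𝓝 (φ f))) {δ M : ℝ} (hδ : 0 < δ)
    (hM : ‖φ‖ ≤ M) (hd : ∀ x : F, δ ≤ ‖φ - NormedSpace.inclusionInDoubleDual 𝕜 F x‖)
    {p : T → Prop} (hp : ∀ᶠ t in l, p t) (n : ℕ) :
    ∃ s : Fin n → T, (∀ j, p (s j)) ∧ IsBasicWith 𝕜 (4 * (1 + M / δ)) (fun j => y (s j)) ∧
      ∀ a : Fin n → ℝ, (∀ i, 0 ≤ a i) → ∑ i, a i = 1 →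
        δ / 2 ≤ ‖∑ i, (a i : 𝕜) • y (s i)‖ := by
  classical
  set J := NormedSpace.inclusionInDoubleDual 𝕜 F
  have hM0 : 0 ≤ M := (norm_nonneg φ).trans hM
  set K : ℝ := 1 + M / δ with hK
  have hK1 : 1 ≤ K := by
    have : 0 ≤ M / δ := by positivity
    linarith
  -- the projection onto the space along `φ`
  have hproj : ∀ (x : F) (α : 𝕜), ‖x‖ ≤ K * ‖J x + α • φ‖ := by
    intro x α
    -- The distance from `φ` to the space controls `α`, so removing `α • φ` costs at most `M / δ`
    -- times the norm.
    have h1 : δ * ‖α‖ ≤ ‖J x + α • φ‖ := by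
      rcases eq_or_ne α 0 with rfl | hα
      · simp
      · have h2 := hd (-(α⁻¹ • x))
        have h3 : J x + α • φ = α • (φ - J (-(α⁻¹ • x))) := by
          rw [map_neg, map_smul, sub_neg_eq_add, smul_add, smul_smul, mul_inv_cancel₀ hα, one_smul,
            add_comm]
        rw [h3, norm_smul, mul_comm]
        gcongr
    have h4 : ‖J x‖ = ‖x‖ := (NormedSpace.inclusionInDoubleDualLi (𝕜 := 𝕜) (E := F)).norm_map x
    have h5 : ‖J x‖ ≤ ‖J x + α • φ‖ + ‖α‖ * M := by
      calc ‖J x‖ = ‖(J x + α • φ) - α • φ‖ := by rw [add_sub_cancel_right]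
        _ ≤ ‖J x + α • φ‖ + ‖α • φ‖ := norm_sub_le _ _
        _ ≤ _ := by rw [norm_smul]; gcongr
    have h6 : ‖α‖ ≤ ‖J x + α • φ‖ / δ := by rw [le_div_iff₀ hδ]; linarith
    have h7 : ‖α‖ * M ≤ ‖J x + α • φ‖ / δ * M := by gcongr
    have h8 : K * ‖J x + α • φ‖ = ‖J x + α • φ‖ + ‖J x + α • φ‖ / δ * M := by
      rw [hK]; ring
    linarith
  -- a functional bounding convex combinations from below
  obtain ⟨f₀, hf₀, hre⟩ : ∃ f₀ : StrongDual 𝕜 F, ‖f₀‖ ≤ 1 ∧ δ / 2 < RCLike.re (φ f₀) := by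
    have h1 : δ / 2 < ‖φ‖ := by
      have := hd 0
      rw [map_zero, sub_zero] at this
      linarith
    obtain ⟨f, hf, hfφ⟩ := exists_norm_le_one_lt_norm_apply φ h1
    obtain ⟨c, hc, hcf⟩ := RCLike.exists_norm_eq_mul_self (φ f)
    refine ⟨c • f, by rw [norm_smul, hc, one_mul]; exact hf, ?_⟩
    rw [map_smul, smul_eq_mul, ← hcf, RCLike.ofReal_re]
    exact hfφ
  have hev₀ : ∀ᶠ t in l, δ / 2 < RCLike.re (f₀ (y t)) :=
    ((RCLike.continuous_re.tendsto _).comp (hφ f₀)).eventually (lt_mem_nhds hre)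
  -- Chosen so that `4 * n * C * ε ≤ d` for `C = 2 * K` and `d = δ / 2`; `n + 1` also covers `n =
  -- 0`.
  set ε : ℝ := δ / (16 * (n + 1) * K) with hε
  have hεpos : 0 < ε := by positivity
  -- states: an index, a finite-dimensional subspace, and a finite set of functionals
  let P : T × Submodule 𝕜 F × Finset (StrongDual 𝕜 F) → Prop := fun q =>
    p q.1 ∧ δ / 2 < RCLike.re (f₀ (y q.1)) ∧ y q.1 ∈ q.2.1 ∧ q.2.1.FG ∧
      (∀ f ∈ q.2.2, ‖f‖ ≤ 1) ∧
      ∀ x ∈ q.2.1, ∀ α : 𝕜, J x + α • φ ≠ 0 →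
        ∃ f ∈ q.2.2, ‖J x + α • φ‖ ≤ 2 * ‖(J x + α • φ) f‖
  let r : T × Submodule 𝕜 F × Finset (StrongDual 𝕜 F) →
      T × Submodule 𝕜 F × Finset (StrongDual 𝕜 F) → Prop := fun q q' =>
    q.2.1 ≤ q'.2.1 ∧ ∀ f ∈ q.2.2, ‖f (y q'.1) - φ f‖ ≤ ε
  obtain ⟨s, hsP, hsr⟩ := exists_seq_of_forall_finset_exists P r (by
    intro A hA
    have hev : ∀ᶠ t in l, ∀ q ∈ A, ∀ f ∈ q.2.2, ‖f (y t) - φ f‖ ≤ ε := by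
      rw [eventually_all_finset]
      intro q _
      rw [eventually_all_finset]
      intro f _
      have := (hφ f).sub_const (φ f)
      rw [sub_self] at this
      have h2 := this.norm
      rw [norm_zero] at h2
      exact (h2.eventually (gt_mem_nhds hεpos)).mono fun t ht => ht.le
    obtain ⟨t, ht1, ht2, ht3⟩ := (hp.and (hev₀.and hev)).exists
    -- `W` absorbs the earlier subspaces, so it contains every head ending here. The norming set
    -- must also see `φ`, because later vectors act on it like `φ`.
    let W : Submodule 𝕜 F := Submodule.span 𝕜 {y t} ⊔ A.sup fun q => q.2.1
    have hW : W.FG := (Submodule.fg_span_singleton _).sup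
      (Submodule.fg_finset_sup A _ fun q hq => (hA q hq).2.2.2.1)
    have : FiniteDimensional 𝕜 W := Module.Finite.iff_fg.2 hW
    obtain ⟨Φ, hΦ1, hΦ2⟩ := exists_finset_norming
      (W.map (J : F →ₗ[𝕜] StrongDual 𝕜 (StrongDual 𝕜 F)) ⊔ Submodule.span 𝕜 {φ})
    refine ⟨(t, W, Φ), ⟨ht1, ht2, ?_, hW, hΦ1, ?_⟩, ?_⟩
    · exact Submodule.mem_sup_left (Submodule.mem_span_singleton_self _)
    · intro x hx α hne
      refine hΦ2 _ (Submodule.add_mem_sup (Submodule.mem_map_of_mem hx) ?_) hne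
      exact Submodule.smul_mem _ _ (Submodule.mem_span_singleton_self _)
    · intro q hq
      exact ⟨(Finset.le_sup (f := fun q : T × Submodule 𝕜 F × Finset (StrongDual 𝕜 F) => q.2.1)
        hq).trans le_sup_right, fun f hf => ht3 q hq f hf⟩)
  have hWmono : ∀ i j, i ≤ j → (s i).2.1 ≤ (s j).2.1 := fun i j hij => by
    rcases hij.eq_or_lt with rfl | h
    · exact le_rfl
    · exact (hsr i j h).1
  have hlow : ∀ a : Fin n → ℝ, (∀ i, 0 ≤ a i) → ∑ i, a i = 1 →
      δ / 2 ≤ ‖∑ i, (a i : 𝕜) • y (s i).1‖ := by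
    intro a ha hsum
    calc δ / 2 = ∑ i, a i * (δ / 2) := by rw [← Finset.sum_mul, hsum, one_mul]
      _ ≤ ∑ i, a i * RCLike.re (f₀ (y (s i).1)) :=
        Finset.sum_le_sum fun i _ => mul_le_mul_of_nonneg_left (hsP i).2.1.le (ha i)
      _ = RCLike.re (f₀ (∑ i, (a i : 𝕜) • y (s i).1)) := by
        simp [map_sum]
      _ ≤ ‖f₀ (∑ i, (a i : 𝕜) • y (s i).1)‖ := RCLike.re_le_norm _
      _ ≤ 1 * ‖∑ i, (a i : 𝕜) • y (s i).1‖ := f₀.le_of_opNorm_le hf₀ _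
      _ = _ := one_mul _
  refine ⟨fun i => (s i).1, fun i => (hsP i).1, ?_, hlow⟩
  have h4K : 4 * K = 2 * (2 * K) := by ring
  rw [h4K]
  have hn1 : (0 : ℝ) < n + 1 := by positivity
  refine isBasicWith_of_norm_le_add (ε := ε) (d := δ / 2) (by positivity) (by positivity)
    ?_ ?_ ?_
  · have : 4 * n * (2 * K) * ε = δ / 2 * (n / (n + 1)) := by
      rw [hε]; field_simp; ring
    rw [this]
    have h1 : (n : ℝ) / (n + 1) ≤ 1 := by rw [div_le_one hn1]; linarith
    have h2 : δ / 2 * (n / (n + 1)) ≤ δ / 2 * 1 := by gcongr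
    linarith
  · intro i
    calc δ / 2 ≤ RCLike.re (f₀ (y (s i).1)) := (hsP i).2.1.le
      _ ≤ ‖f₀ (y (s i).1)‖ := RCLike.re_le_norm _
      _ ≤ 1 * ‖y (s i).1‖ := f₀.le_of_opNorm_le hf₀ _
      _ = _ := one_mul _
  · intro a m
    have hR0 : 0 ≤ ∑ i, ‖a i‖ := Finset.sum_nonneg fun i _ => norm_nonneg _
    -- A head of length `k + 1` lies in the subspace of stage `k`. Since `s` is indexed by `ℕ`,
    -- stage `k` exists even when `k ≥ n`.
    rcases m with _ | k
    · simp only [Nat.not_lt_zero, Finset.filter_false, Finset.sum_empty, norm_zero]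
      positivity
    set x := ∑ i with i.val < k + 1, a i • y (s i).1 with hx
    set α := ∑ i with ¬ i.val < k + 1, a i with hα
    have hxW : x ∈ (s k).2.1 := by
      refine Submodule.sum_mem _ fun i hi => Submodule.smul_mem _ _ ?_
      refine hWmono i k ?_ (hsP i).2.2.1
      have := (Finset.mem_filter.1 hi).2
      omega
    by_cases hne : J x + α • φ = 0
    · have h1 := hproj x α
      rw [hne, norm_zero, mul_zero] at h1
      exact h1.trans (by positivity)
    obtain ⟨f, hfΦ, hf⟩ := (hsP k).2.2.2.2.2 x hxW α hne
    have hfn := (hsP k).2.2.2.2.1 f hfΦ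
    -- On `f`, the tail acts as `α • φ` up to errors of size `ε`, so the full sum nearly norms `J x
    -- + α • φ`.
    have h2 : (J x + α • φ) f = f (∑ i, a i • y (s i).1) -
        ∑ i with ¬ i.val < k + 1, a i * (f (y (s i).1) - φ f) := by
      have e : (J x + α • φ) f = f x + α * φ f := rfl
      have e' : f (∑ i with ¬ i.val < k + 1, a i • y (s i).1) =
          ∑ i with ¬ i.val < k + 1, a i * f (y (s i).1) := by simp [map_sum]
      rw [e, ← Finset.sum_filter_add_sum_filter_not Finset.univ (fun i : Fin n => i.val < k + 1)
        (fun i => a i • y (s i).1), map_add, ← hx, e']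
      simp only [mul_sub, Finset.sum_sub_distrib, ← Finset.sum_mul, ← hα]
      ring
    have h3 : ‖∑ i with ¬ i.val < k + 1, a i * (f (y (s i).1) - φ f)‖ ≤ ε * ∑ i, ‖a i‖ := by
      refine (norm_sum_le _ _).trans ?_
      rw [Finset.mul_sum]
      refine (Finset.sum_le_sum fun i hi => ?_).trans
        (Finset.sum_le_sum_of_subset_of_nonneg (Finset.filter_subset _ _)
          fun i _ _ => mul_nonneg hεpos.le (norm_nonneg (a i)))
      rw [norm_mul, mul_comm]
      gcongr
      refine (hsr k i ?_).2 f hfΦ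
      have := (Finset.mem_filter.1 hi).2
      omega
    have h4 : ‖f (∑ i, a i • y (s i).1)‖ ≤ ‖∑ i, a i • y (s i).1‖ := by
      simpa using f.le_of_opNorm_le hfn (∑ i, a i • y (s i).1)
    calc ‖x‖ ≤ K * ‖J x + α • φ‖ := hproj x α
      _ ≤ K * (2 * ‖(J x + α • φ) f‖) := by gcongr
      _ ≤ K * (2 * (‖∑ i, a i • y (s i).1‖ + ε * ∑ i, ‖a i‖)) := by
        gcongr
        rw [h2]
        exact (norm_sub_le _ _).trans (add_le_add h4 h3)
      _ = _ := by ring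

end Basic

/-! ### Stability of basic sequences -/

section BasicStability

variable {𝕜 : Type t} [RCLike 𝕜] {F : Type u} [NormedAddCommGroup F] [NormedSpace 𝕜 F]
  {G : Type v} [NormedAddCommGroup G] [NormedSpace 𝕜 G]

theorem sum_smul_filter_eq {n : ℕ} (a : Fin n → 𝕜) (y : Fin n → F) (m : ℕ) :
    ∑ i with i.val < m, a i • y i = ∑ i : Fin n, (if i.val < m then a i else 0) • y i := by
  simp [Finset.sum_filter, ite_smul]

/-- A sequence whose linear combinations have nearly the same norms as those of a basic sequence is
basic. -/
theorem IsBasicWith.of_abs_norm_sub_le {n : ℕ} {c : ℝ} (hc : 0 ≤ c) {y : Fin n → F} {z : Fin n → G}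
    (hy : IsBasicWith 𝕜 c y)
    (h : ∀ a : Fin n → 𝕜, |‖∑ i, a i • z i‖ - ‖∑ i, a i • y i‖| ≤ 1 / 2 * ‖∑ i, a i • y i‖) :
    IsBasicWith 𝕜 (3 * c) z := by
  constructor
  · intro i hi
    have h1 := h (Pi.single i 1)
    simp only [Pi.single_apply, ite_smul, one_smul, zero_smul, Finset.sum_ite_eq',
      Finset.mem_univ, if_true, hi, norm_zero, zero_sub, abs_neg, abs_norm] at h1
    have := norm_pos_iff.2 (hy.1 i)
    linarith
  · intro a m
    have h1 := abs_le.1 (h a)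
    -- The comparison costs `3 / 2` on the head and `2` on the full sum, hence the factor `3`.
    have h2 := abs_le.1 (h fun i => if i.val < m then a i else 0)
    rw [← sum_smul_filter_eq, ← sum_smul_filter_eq] at h2
    have h3 := hy.2 a m
    have h4 : c * ‖∑ i, a i • y i‖ ≤ c * (2 * ‖∑ i, a i • z i‖) := by
      gcongr
      linarith
    linarith

theorem IsBasicWith.const_smul {n : ℕ} {c : ℝ} {y : Fin n → F} (hy : IsBasicWith 𝕜 c y) {k : 𝕜}
    (hk : k ≠ 0) : IsBasicWith 𝕜 c fun i => k • y i := by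
  refine ⟨fun i => smul_ne_zero hk (hy.1 i), fun a m => ?_⟩
  simpa only [mul_smul] using hy.2 (fun i => a i * k) m

/-- The coefficients of a basic sequence are bounded. -/
theorem IsBasicWith.sum_norm_le {n : ℕ} {c d : ℝ} {y : Fin n → F} (hy : IsBasicWith 𝕜 c y)
    (hd : ∀ i, d ≤ ‖y i‖) (a : Fin n → 𝕜) :
    d * ∑ i, ‖a i‖ ≤ 2 * n * c * ‖∑ i, a i • y i‖ := by
  have h1 : ∀ i, d * ‖a i‖ ≤ 2 * (c * ‖∑ i, a i • y i‖) := fun i => by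
    have e := sum_filter_val_lt_succ (fun i => a i • y i) i
    have e' : a i • y i = (∑ k with k.val < i.val + 1, a k • y k) -
        ∑ k with k.val < i.val, a k • y k := by rw [e]; abel
    calc d * ‖a i‖ ≤ ‖y i‖ * ‖a i‖ := by gcongr; exact hd i
      _ = ‖a i • y i‖ := by rw [norm_smul, mul_comm]
      _ ≤ ‖∑ k with k.val < i.val + 1, a k • y k‖ + ‖∑ k with k.val < i.val, a k • y k‖ := by
        rw [e']; exact norm_sub_le _ _
      _ ≤ _ := by linarith [hy.2 a (i.val + 1), hy.2 a i.val]
  rw [Finset.mul_sum]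
  refine (Finset.sum_le_sum fun i _ => h1 i).trans (le_of_eq ?_)
  simp
  ring

end BasicStability

/-! ### Limits along ultrafilters -/

section Compactness

variable {I : Type w}

/-- Bounded families in a proper space converge along ultrafilters. -/
theorem Ultrafilter.exists_tendsto_of_norm_le (U : Ultrafilter I) {V : Type v}
    [NormedAddCommGroup V] [ProperSpace V] {x : I → V} {C : ℝ} (hx : ∀ᶠ i in U, ‖x i‖ ≤ C) :
    ∃ v, ‖v‖ ≤ C ∧ Tendsto x U (𝓝 v) := by
  obtain ⟨v, hv, hle⟩ := (isCompact_closedBall (0 : V) C).ultrafilter_le_nhds (U.map x) (by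
    rw [le_principal_iff]
    exact hx.mono fun i hi => mem_closedBall_zero_iff.2 hi)
  exact ⟨v, mem_closedBall_zero_iff.1 hv, hle⟩

end Compactness

/-! ### Norms in ultrapowers -/

namespace BanachUltrapower

variable {𝕜 : Type t} [RCLike 𝕜] {I : Type w} {X : Type u} [NormedAddCommGroup X] [NormedSpace 𝕜 X]

/-- The norm of an element of the ultrapower is the limit of the norms of its coordinates. -/
theorem tendsto_norm_mk (U : Ultrafilter I) (x : lp (fun _ : I => X) ∞) :
    Tendsto (fun i => ‖x i‖) U (𝓝 ‖(Submodule.Quotient.mk x : Ultrapower 𝕜 U X)‖) := by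
  classical
  obtain ⟨L, -, hL⟩ := U.exists_tendsto_of_norm_le (x := fun i => ‖x i‖) (C := ‖x‖)
    (Eventually.of_forall fun i => by
      simpa using lp.norm_apply_le_norm ENNReal.top_ne_zero x i)
  have hL0 : 0 ≤ L := ge_of_tendsto' hL fun i => norm_nonneg _
  suffices h : ‖(Submodule.Quotient.mk x : Ultrapower 𝕜 U X)‖ = L by rwa [h]
  apply le_antisymm
  · refine le_of_forall_pos_le_add fun ε hε => ?_
    have hev : ∀ᶠ i in U, ‖x i‖ < L + ε := hL.eventually (gt_mem_nhds (by linarith))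
    have hb : ∀ i, ‖(if ‖x i‖ < L + ε then x i else 0 : X)‖ ≤ L + ε := fun i => by
      split_ifs with h
      · exact h.le
      · simpa using by linarith
    -- Coordinates change only off a `U`-large set, so the class is unchanged while the supremum
    -- norm drops to at most `L + ε`.
    let x' : lp (fun _ : I => X) ∞ := ⟨fun i => if ‖x i‖ < L + ε then x i else 0,
      memℓp_infty ⟨L + ε, by rintro _ ⟨i, rfl⟩; exact hb i⟩⟩
    have hxx : (Submodule.Quotient.mk x : Ultrapower 𝕜 U X) = Submodule.Quotient.mk x' := by
      rw [Submodule.Quotient.eq, mem_nullSubmodule]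
      refine tendsto_const_nhds.congr' ?_
      filter_upwards [hev] with i hi
      have : x' i = x i := if_pos hi
      simp [this]
    rw [hxx]
    exact (Submodule.Quotient.norm_mk_le _ x').trans
      (lp.norm_le_of_forall_le (by linarith) hb)
  · refine le_of_forall_pos_le_add fun ε hε => ?_
    obtain ⟨x', hx', hn⟩ :=
      Submodule.Quotient.norm_mk_lt (Submodule.Quotient.mk x : Ultrapower 𝕜 U X) hε
    have h0 : Tendsto (fun i => ‖(x - x') i‖) U (𝓝 0) := by
      rw [← mem_nullSubmodule (𝕜 := 𝕜), ← Submodule.Quotient.eq]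
      exact hx'.symm
    have h1 := hL.sub h0
    rw [sub_zero] at h1
    refine (le_of_tendsto' h1 fun i => ?_).trans hn.le
    have h2 := lp.norm_apply_le_norm ENNReal.top_ne_zero x' i
    have h3 : ‖x i‖ ≤ ‖(x - x') i‖ + ‖x' i‖ := by
      simpa using norm_add_le ((x - x') i) (x' i)
    linarith

/-- Finite families in an ultrapower are represented, uniformly in the coefficients, by the
coordinates of their representatives. -/
theorem eventually_abs_norm_sum_sub_le (U : Ultrafilter I) {n : ℕ}
    (x : Fin n → lp (fun _ : I => X) ∞) {η : ℝ} (hη : 0 < η) :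
    ∀ᶠ i in U, ∀ a : Fin n → 𝕜,
      |‖∑ j, a j • x j i‖ - ‖∑ j, a j • (Submodule.Quotient.mk (x j) : Ultrapower 𝕜 U X)‖| ≤
        η * ∑ j, ‖a j‖ := by
  by_contra hcon
  rw [← Ultrafilter.eventually_not] at hcon
  push Not at hcon
  -- Homogeneity bounds the bad coefficients, so they converge along `U`. Both norms then have the
  -- same limit, against the gap `η`.
  have hnorm : ∀ᶠ i in U, ∃ a : Fin n → 𝕜, ‖a‖ ≤ 1 ∧
      η ≤ |‖∑ j, a j • x j i‖ -
        ‖∑ j, a j • (Submodule.Quotient.mk (x j) : Ultrapower 𝕜 U X)‖| := by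
    filter_upwards [hcon] with i ⟨a, ha⟩
    set R := ∑ j, ‖a j‖ with hR
    have hR0 : 0 ≤ R := Finset.sum_nonneg fun j _ => norm_nonneg (a j)
    have hRpos : 0 < R := by
      rcases hR0.eq_or_lt with h | h
      · have h0 : ∀ j, a j = 0 := fun j => by
          have := (Finset.sum_eq_zero_iff_of_nonneg fun j _ => norm_nonneg (a j)).1
            (hR.symm.trans h.symm) j (Finset.mem_univ j)
          exact norm_eq_zero.1 this
        simp [h0, ← h] at ha
      · exact h
    refine ⟨(R⁻¹ : 𝕜) • a, ?_, ?_⟩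
    · rw [pi_norm_le_iff_of_nonneg zero_le_one]
      intro j
      rw [Pi.smul_apply, norm_smul, norm_inv, RCLike.norm_ofReal, abs_of_pos hRpos,
        inv_mul_le_iff₀ hRpos, mul_one]
      exact Finset.single_le_sum (f := fun j => ‖a j‖) (fun j _ => norm_nonneg _)
        (Finset.mem_univ j)
    · have e1 : ∑ j, ((R⁻¹ : 𝕜) • a) j • x j i = (R⁻¹ : 𝕜) • ∑ j, a j • x j i := by
        simp [Finset.smul_sum, mul_smul]
      have e2 : ∑ j, ((R⁻¹ : 𝕜) • a) j • (Submodule.Quotient.mk (x j) : Ultrapower 𝕜 U X) =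
          (R⁻¹ : 𝕜) • ∑ j, a j • (Submodule.Quotient.mk (x j) : Ultrapower 𝕜 U X) := by
        simp [Finset.smul_sum, mul_smul]
      rw [e1, e2, norm_smul, norm_smul, norm_inv, RCLike.norm_ofReal, abs_of_pos hRpos, ← mul_sub,
        abs_mul, abs_of_pos (inv_pos.2 hRpos), le_inv_mul_iff₀ hRpos, mul_comm]
      exact ha.le
  obtain ⟨a, ha⟩ : ∃ a : I → Fin n → 𝕜, ∀ᶠ i in U, ‖a i‖ ≤ 1 ∧
      η ≤ |‖∑ j, a i j • x j i‖ -
        ‖∑ j, a i j • (Submodule.Quotient.mk (x j) : Ultrapower 𝕜 U X)‖| :=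
    ⟨fun i => Classical.epsilon _, hnorm.mono fun i hi => Classical.epsilon_spec hi⟩
  obtain ⟨b, -, hb⟩ := U.exists_tendsto_of_norm_le (ha.mono fun i hi => hi.1)
  have hbj : ∀ j, Tendsto (fun i => a i j) U (𝓝 (b j)) := fun j => tendsto_pi_nhds.1 hb j
  have t1 : Tendsto (fun i => ‖∑ j, a i j • (Submodule.Quotient.mk (x j) : Ultrapower 𝕜 U X)‖) U
      (𝓝 ‖∑ j, b j • (Submodule.Quotient.mk (x j) : Ultrapower 𝕜 U X)‖) :=
    (tendsto_finsetSum _ fun j _ => (hbj j).smul_const _).norm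
  have t2 : Tendsto (fun i => ‖∑ j, b j • x j i‖) U
      (𝓝 ‖∑ j, b j • (Submodule.Quotient.mk (x j) : Ultrapower 𝕜 U X)‖) := by
    have := tendsto_norm_mk (𝕜 := 𝕜) U (∑ j, b j • x j)
    have e : (Submodule.Quotient.mk (∑ j, b j • x j) : Ultrapower 𝕜 U X) =
        ∑ j, b j • (Submodule.Quotient.mk (x j) : Ultrapower 𝕜 U X) :=
      map_sum (nullSubmodule 𝕜 U X).mkQ (fun j => b j • x j) Finset.univ
    rw [e] at this
    refine this.congr fun i => ?_
    rw [lp.coeFn_sum, Finset.sum_apply]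
    rfl
  have t3 : Tendsto (fun i => ‖∑ j, (a i j - b j) • x j i‖) U (𝓝 0) := by
    refine squeeze_zero (fun i => norm_nonneg _)
      (fun i => (norm_sum_le _ _).trans (Finset.sum_le_sum fun j _ =>
        (norm_smul_le _ _).trans (mul_le_mul_of_nonneg_left
          (lp.norm_apply_le_norm ENNReal.top_ne_zero (x j) i) (norm_nonneg _)))) ?_
    have h0 : ∀ j, Tendsto (fun i => ‖a i j - b j‖ * ‖x j‖) U (𝓝 0) := fun j => by
      simpa using ((hbj j).sub_const (b j)).norm.mul_const ‖x j‖
    simpa using tendsto_finsetSum Finset.univ fun j _ => h0 j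
  have t4 : Tendsto (fun i => ‖∑ j, a i j • x j i‖) U
      (𝓝 ‖∑ j, b j • (Submodule.Quotient.mk (x j) : Ultrapower 𝕜 U X)‖) := by
    refine tendsto_of_tendsto_of_dist t2 (squeeze_zero (fun _ => dist_nonneg) (fun i => ?_) t3)
    rw [dist_comm, Real.dist_eq]
    refine (abs_norm_sub_norm_le _ _).trans (le_of_eq ?_)
    simp [sub_smul]
  have t5 := (t4.sub t1).abs
  rw [sub_self, abs_zero] at t5
  exact absurd (ge_of_tendsto t5 (ha.mono fun i hi => hi.2)) (not_le.2 hη)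

/-- The diagonal embedding of a space into its ultrapower. -/
def diag (U : Ultrafilter I) (X : Type u) [NormedAddCommGroup X] [NormedSpace 𝕜 X] :
    X →L[𝕜] Ultrapower 𝕜 U X :=
  LinearMap.mkContinuous
    { toFun := fun x => Submodule.Quotient.mk
        (⟨fun _ => x, memℓp_infty ⟨‖x‖, by rintro _ ⟨i, rfl⟩; exact le_rfl⟩⟩ :
          lp (fun _ : I => X) ∞)
      map_add' := fun _ _ => rfl
      map_smul' := fun _ _ => rfl } 1 (fun x => by
    rw [one_mul]
    exact (Submodule.Quotient.norm_mk_le _ _).trans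
      (lp.norm_le_of_forall_le (norm_nonneg x) fun _ => le_rfl))

end BanachUltrapower

/-! ### Failure of weak compactness seen in the bidual -/

section WeakCompactness

variable {𝕜 : Type t} [RCLike 𝕜] {E : Type u} [NormedAddCommGroup E] [NormedSpace 𝕜 E]
  {F : Type v} [NormedAddCommGroup F] [NormedSpace 𝕜 F]

/-- If an operator is not weakly compact, then some weak-star limit of images of vectors of the unit
ball lies outside the space. -/
theorem exists_ultrafilter_of_not_isWeaklyCompactOperator {B : E →L[𝕜] F}
    (hB : ¬ IsWeaklyCompactOperator B) :
    ∃ (l : Ultrafilter E) (φ : StrongDual 𝕜 (StrongDual 𝕜 F)),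
      (∀ᶠ x in (l : Filter E), ‖x‖ ≤ 1) ∧ (∀ f : StrongDual 𝕜 F, Tendsto (fun x => f (B x)) l (𝓝 (φ f))) ∧
      φ ∉ Set.range (NormedSpace.inclusionInDoubleDual 𝕜 F) := by
  let S : Set (WeakSpace 𝕜 F) := toWeakSpace 𝕜 F '' (B '' Metric.closedBall (0 : E) 1)
  let j := NormedSpace.inclusionInDoubleDualWeak 𝕜 F
  -- A bounded set whose weak-star closure in the bidual stays inside the space is relatively weakly
  -- compact.
  have hnot : ¬ closure (j '' S) ⊆ Set.range j := by
    intro hr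
    refine hB (NormedSpace.isCompact_closure_of_isBounded 𝕜 F S ?_ hr)
    have h1 : Bornology.IsBounded (B '' Metric.closedBall (0 : E) 1) :=
      B.lipschitz.isBounded_image Metric.isBounded_closedBall
    rwa [← Set.preimage_image_eq (B '' _) (toWeakSpace 𝕜 F).injective] at h1
  obtain ⟨Ψ, hΨ, hΨr⟩ := Set.not_subset.1 hnot
  obtain ⟨u, hu, hle⟩ := mem_closure_iff_ultrafilter.1 hΨ
  let g : E → WeakDual 𝕜 (StrongDual 𝕜 F) := fun x => j (toWeakSpace 𝕜 F (B x))
  have himg : g '' Metric.closedBall (0 : E) 1 ∈ (u : Filter _) := by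
    have : g '' Metric.closedBall (0 : E) 1 = j '' S := by
      simp only [S, g, Set.image_image]
    rw [this]
    exact hu
  have : (comap g u ⊓ 𝓟 (Metric.closedBall (0 : E) 1)).NeBot :=
    comap_inf_principal_neBot_of_image_mem u.neBot himg
  let l := Ultrafilter.of (comap g u ⊓ 𝓟 (Metric.closedBall (0 : E) 1))
  have hl := Ultrafilter.of_le (comap g u ⊓ 𝓟 (Metric.closedBall (0 : E) 1))
  refine ⟨l, WeakDual.toStrongDual Ψ, ?_, ?_, ?_⟩
  · have h1 : Metric.closedBall (0 : E) 1 ∈ (l : Filter E) :=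
      (hl.trans inf_le_right) (mem_principal_self _)
    exact mem_of_superset h1 fun x hx => mem_closedBall_zero_iff.1 hx
  · intro f
    have h1 : Tendsto g l (𝓝 Ψ) :=
      (tendsto_comap.mono_left (hl.trans inf_le_left)).mono_right hle
    exact ((WeakDual.eval_continuous f).tendsto Ψ).comp h1
  · rintro ⟨y, hy⟩
    exact hΨr ⟨toWeakSpace 𝕜 F y, hy⟩

/-- Completeness makes the isometric image of `F` closed in its bidual. -/
theorem exists_pos_le_norm_sub_inclusionInDoubleDual [CompleteSpace F]
    {φ : StrongDual 𝕜 (StrongDual 𝕜 F)}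
    (hφ : φ ∉ Set.range (NormedSpace.inclusionInDoubleDual 𝕜 F)) :
    ∃ δ > 0, ∀ y, δ ≤ ‖φ - NormedSpace.inclusionInDoubleDual 𝕜 F y‖ := by
  have hcl : IsClosed (Set.range (NormedSpace.inclusionInDoubleDual 𝕜 F)) :=
    (NormedSpace.inclusionInDoubleDualLi (𝕜 := 𝕜) (E := F)).isometry.isClosedEmbedding.isClosed_range
  refine ⟨Metric.infDist φ (Set.range (NormedSpace.inclusionInDoubleDual 𝕜 F)),
    (hcl.notMem_iff_infDist_pos (Set.range_nonempty _)).1 hφ, fun y => ?_⟩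
  rw [← dist_eq_norm]
  exact Metric.infDist_le_dist_of_mem ⟨y, rfl⟩

end WeakCompactness

/-! ### Correction into a subspace of finite codimension -/

section FiniteCodimension

variable {𝕜 : Type t} [RCLike 𝕜] {X : Type u} [NormedAddCommGroup X] [NormedSpace 𝕜 X]

/-- Bounded families of vectors, indexed by `I` along an ultrafilter, can be corrected by vectors
converging along a second ultrafilter so as to come close to a subspace of finite codimension. -/
theorem exists_correction {I : Type w} (U : Ultrafilter I) {T : Type v} (l : Ultrafilter T)
    (Z : Submodule 𝕜 X) [FiniteDimensional 𝕜 (X ⧸ Z)] {x : T → I → X} {C : T → ℝ} {ρ : ℝ}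
    (hC : ∀ t i, ‖x t i‖ ≤ C t) (hρ : ∀ᶠ t in l, C t ≤ ρ) :
    ∃ (σ : T → X) (b : X), ‖b‖ ≤ ρ + 1 ∧ Tendsto σ l (𝓝 b) ∧
      ∀ t, ∀ ε > 0, ∀ᶠ i in U, ∃ z ∈ Z, ‖z - (x t i - σ t)‖ < ε := by
  -- Passing to the closure gives a normed quotient, still finite-dimensional; density of `Z` in
  -- `Z'` brings the vectors back at the end.
  let Z' := Z.topologicalClosure
  have hZ' : IsClosed (Z' : Set X) := Z.isClosed_topologicalClosure
  have hfin : FiniteDimensional 𝕜 (X ⧸ Z') :=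
    Module.Finite.of_surjective (Submodule.factor Z.le_topologicalClosure)
      (Submodule.factor_surjective Z.le_topologicalClosure)
  have : ProperSpace (X ⧸ Z') := FiniteDimensional.proper_rclike 𝕜 (X ⧸ Z')
  have hQ : ∀ t, ∃ v : X ⧸ Z', ‖v‖ ≤ C t ∧ Tendsto (fun i => Z'.mkQ (x t i)) U (𝓝 v) := fun t =>
    U.exists_tendsto_of_norm_le (Eventually.of_forall fun i =>
      (Submodule.Quotient.norm_mk_le Z' (x t i)).trans (hC t i))
  choose Q hQC hQ using hQ
  obtain ⟨m, hm, hml⟩ := l.exists_tendsto_of_norm_le (hρ.mono fun t ht => (hQC t).trans ht)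
  obtain ⟨b, hb, hbn⟩ := Submodule.Quotient.norm_mk_lt m one_pos
  have hlift : ∀ v : X ⧸ Z', ∃ y : X, Z'.mkQ y = v ∧ ‖y‖ ≤ 2 * ‖v‖ := fun v => by
    rcases eq_or_ne v 0 with rfl | hv
    · exact ⟨0, map_zero _, by simp⟩
    · obtain ⟨y, hy, hyn⟩ := Submodule.Quotient.norm_mk_lt v (norm_pos_iff.2 hv)
      exact ⟨y, hy, by linarith⟩
  choose r hr hrn using hlift
  -- `σ t` lifts the limit class `Q t`. Lifting only `Q t - m` through `r` forces norm convergence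
  -- to `b`, although `r` need not be linear.
  refine ⟨fun t => b + r (Q t - m), b, by linarith, ?_, ?_⟩
  · have h1 : Tendsto (fun t => r (Q t - m)) l (𝓝 0) := by
      refine squeeze_zero_norm (fun t => hrn (Q t - m)) ?_
      simpa using ((hml.sub_const m).norm).const_mul 2
    simpa using h1.const_add b
  · intro t ε hε
    have h1 : Tendsto (fun i => ‖Z'.mkQ (x t i - (b + r (Q t - m)))‖) U (𝓝 0) := by
      have hb' : Z'.mkQ b = m := hb
      have h2 := ((hQ t).sub_const (Q t)).norm
      rw [sub_self, norm_zero] at h2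
      refine h2.congr fun i => ?_
      rw [map_sub, map_add, hr, hb', add_sub_cancel]
    filter_upwards [h1.eventually (gt_mem_nhds (half_pos hε))] with i hi
    set d := x t i - (b + r (Q t - m))
    obtain ⟨y, hy, hyn⟩ := Submodule.Quotient.norm_mk_lt (Z'.mkQ d) (sub_pos.2 hi)
    have hmem : d - y ∈ Z' := (Submodule.Quotient.eq Z').1 hy.symm
    obtain ⟨z, hz, hzd⟩ := Metric.mem_closure_iff.1
      (show d - y ∈ closure (Z : Set X) from hmem) (ε / 2) (half_pos hε)
    refine ⟨z, hz, ?_⟩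
    rw [dist_comm, dist_eq_norm] at hzd
    have h3 : z - d = (z - (d - y)) - y := by abel
    rw [h3]
    refine (norm_sub_le _ _).trans_lt ?_
    linarith

end FiniteCodimension

/-! ### The main theorem -/

open BanachUltrapower in
theorem mainTheorem3 {𝕜 : Type t} [RCLike 𝕜]
    {X : Type u} [NormedAddCommGroup X] [NormedSpace 𝕜 X] [CompleteSpace X]
    {Y : Type v} [NormedAddCommGroup Y] [NormedSpace 𝕜 Y] [CompleteSpace Y]
    (A : X →L[𝕜] Y) (hA : ¬ IsSuperWeaklyCompactOperator.{t, u, v, w} A) :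
    ∃ ψ : ℝ, 0 < ψ ∧ ∃ c : ℝ, 1 ≤ c ∧
      ∀ (n : ℕ) (Z : Submodule 𝕜 X), FiniteDimensional 𝕜 (X ⧸ Z) →
        ∃ z : Fin n → X, (∀ i, z i ∈ Z ∧ ‖z i‖ ≤ 1) ∧
          IsBasicWith 𝕜 c (fun i => A (z i)) ∧
          ∀ a : Fin n → ℝ, (∀ i, 0 ≤ a i) → ∑ i, a i = 1 →
            ψ ≤ ‖∑ i, (a i : 𝕜) • A (z i)‖ := by
  unfold IsSuperWeaklyCompactOperator at hA
  push Not at hA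
  obtain ⟨I, U, hU⟩ := hA
  obtain ⟨l, φ, hl1, hlφ, hφr⟩ := exists_ultrafilter_of_not_isWeaklyCompactOperator hU
  obtain ⟨δ, hδ, hd⟩ := exists_pos_le_norm_sub_inclusionInDoubleDual hφr
  set J := NormedSpace.inclusionInDoubleDual 𝕜 (Ultrapower 𝕜 U Y)
  have hrep : ∀ x : Ultrapower 𝕜 U X, ∃ r : lp (fun _ : I => X) ∞,
      Submodule.Quotient.mk r = x ∧ ‖r‖ < ‖x‖ + 1 := fun x =>
    Submodule.Quotient.norm_mk_lt x one_pos
  choose r hr hrn using hrep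
  let D : X →L[𝕜] Ultrapower 𝕜 U Y := diag U Y ∘L A
  -- The `3` bounds `‖b‖` for every `Z`: representatives have norm at most `2`, and lifting their
  -- limit class costs at most `1`.
  set M := ‖φ‖ + ‖D‖ * 3 with hM
  set c := 4 * (1 + M / δ) with hc
  have hc4 : 4 ≤ c := by
    have : 0 ≤ M / δ := by positivity
    linarith
  -- The lower bound `δ / 2` is halved by the approximation and divided by `8` in the rescaling.
  refine ⟨δ / 32, by positivity, 3 * c, by linarith, fun n Z hZ => ?_⟩
  obtain ⟨σ, b, hb, hσ, hcor⟩ := exists_correction U l Z (x := fun x i => r x i)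
    (C := fun x => ‖r x‖) (ρ := 2)
    (fun x i => lp.norm_apply_le_norm ENNReal.top_ne_zero (r x) i)
    (hl1.mono fun x hx => by linarith [hrn x])
  let y : Ultrapower 𝕜 U X → Ultrapower 𝕜 U Y := fun x => ultrapowerMap U A x - D (σ x)
  have hyφ : ∀ f : StrongDual 𝕜 (Ultrapower 𝕜 U Y),
      Tendsto (fun x => f (y x)) l (𝓝 ((φ - J (D b)) f)) := by
    intro f
    have h1 : Tendsto (fun x => f (D (σ x))) l (𝓝 (f (D b))) :=
      ((f ∘L D).continuous.tendsto b).comp hσ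
    have h2 := (hlφ f).sub h1
    have e : (φ - J (D b)) f = φ f - f (D b) := rfl
    rw [e]
    simpa only [y, map_sub] using h2
  have hMb : ‖φ - J (D b)‖ ≤ M := by
    refine (norm_sub_le _ _).trans ?_
    rw [hM]
    gcongr
    refine (NormedSpace.double_dual_bound 𝕜 _ (D b)).trans ((D.le_opNorm b).trans ?_)
    gcongr
    linarith
  -- The shift `D b` lies in the space, so the distance bound survives.
  have hdb : ∀ x, δ ≤ ‖φ - J (D b) - J x‖ := fun x => by
    have := hd (D b + x)
    rwa [map_add, ← sub_sub] at this
  have hp : ∀ᶠ x in l, ‖x‖ ≤ 1 ∧ ‖σ x‖ ≤ 4 := by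
    refine hl1.and ?_
    exact (hσ.norm.eventually (gt_mem_nhds (show ‖b‖ < 4 by linarith))).mono fun x hx => hx.le
  obtain ⟨s, hs, hbasic, hlow⟩ := exists_isBasicWith_of_tendsto hyφ hδ hMb hdb hp n
  rw [← hc] at hbasic
  -- representatives of the basic sequence in the ultrapower
  let q : Fin n → lp (fun _ : I => Y) ∞ := fun j =>
    linftyMap I A (r (s j) - (⟨fun _ => σ (s j), memℓp_infty
      ⟨‖σ (s j)‖, by rintro _ ⟨i, rfl⟩; exact le_rfl⟩⟩ : lp (fun _ : I => X) ∞))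
  have hq : ∀ j, (Submodule.Quotient.mk (q j) : Ultrapower 𝕜 U Y) = y (s j) := by
    intro j
    change _ = ultrapowerMap U A (s j) - D (σ (s j))
    nth_rw 1 [← hr (s j)]
    rw [ultrapowerMap_mk]
    simp only [q, map_sub]
    rfl
  have hqi : ∀ j i, q j i = A (r (s j) i - σ (s j)) := fun j i => rfl
  -- Two errors of size `η * R` occur, from passing to a coordinate and from moving into `Z`; this
  -- `η` keeps their sum below `S / 2`.
  set η := δ / (16 * (n + 1) * c) with hη
  have hcpos : 0 < c := by linarith
  have hηpos : 0 < η := by positivity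
  set ε := min 1 (η / (‖A‖ + 1)) with hε
  have hεpos : 0 < ε := by positivity
  have hεA : ‖A‖ * ε ≤ η := by
    have hA1 : 0 < ‖A‖ + 1 := by positivity
    calc ‖A‖ * ε ≤ (‖A‖ + 1) * (η / (‖A‖ + 1)) := by
          gcongr
          · linarith
          · exact min_le_right _ _
      _ = η := by field_simp
  obtain ⟨i, hi1, hi2⟩ := ((eventually_abs_norm_sum_sub_le (𝕜 := 𝕜) U q hηpos).and
    (eventually_all.2 fun j => hcor (s j) ε hεpos)).exists
  choose z hzZ hz using hi2
  simp only [hq] at hi1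
  have hynorm : ∀ j, δ / 2 ≤ ‖y (s j)‖ := fun j => by
    have := hlow (Pi.single j 1) (fun k => by
      by_cases h : k = j <;> simp [h]) (by simp)
    simpa [Pi.single_apply, ite_smul, apply_ite] using this
  have hclose : ∀ a : Fin n → 𝕜,
      |‖∑ j, a j • A (z j)‖ - ‖∑ j, a j • y (s j)‖| ≤ 1 / 2 * ‖∑ j, a j • y (s j)‖ := by
    intro a
    have h1 := hi1 a
    have h2 : |‖∑ j, a j • A (z j)‖ - ‖∑ j, a j • q j i‖| ≤ η * ∑ j, ‖a j‖ := by
      refine (abs_norm_sub_norm_le _ _).trans ?_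
      rw [← Finset.sum_sub_distrib, Finset.mul_sum]
      refine (norm_sum_le _ _).trans (Finset.sum_le_sum fun j _ => ?_)
      rw [← smul_sub, hqi, ← map_sub, norm_smul, mul_comm]
      gcongr
      exact (A.le_opNorm _).trans
        ((mul_le_mul_of_nonneg_left (hz j).le (norm_nonneg A)).trans hεA)
    have h3 := hbasic.sum_norm_le hynorm a
    set R := ∑ j, ‖a j‖
    set S := ‖∑ j, a j • y (s j)‖
    have hS0 : 0 ≤ S := norm_nonneg _
    have h4 : 2 * η * R ≤ 1 / 2 * S := by
      have hn1 : (0 : ℝ) < n + 1 := by positivity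
      calc 2 * η * R = (δ / 2 * R) / (4 * (n + 1) * c) := by rw [hη]; field_simp; ring
        _ ≤ (2 * n * c * S) / (4 * (n + 1) * c) := by gcongr
        _ = 1 / 2 * S * (n / (n + 1)) := by field_simp; ring
        _ ≤ 1 / 2 * S * 1 := by
          gcongr
          rw [div_le_one hn1]
          linarith
        _ = 1 / 2 * S := mul_one _
    have h5 := abs_sub_le ‖∑ j, a j • A (z j)‖ ‖∑ j, a j • q j i‖ S
    linarith
  have h8 : ((8 : ℝ)⁻¹ : 𝕜) ≠ 0 := by simp
  have h8n : ‖((8 : ℝ)⁻¹ : 𝕜)‖ = 8⁻¹ := by simp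
  -- Representative, correction and perturbation contribute at most `2 + 4 + 1 < 8` to the norm of
  -- `z j`.
  refine ⟨fun j => ((8 : ℝ)⁻¹ : 𝕜) • z j, fun j => ⟨Z.smul_mem _ (hzZ j), ?_⟩, ?_, ?_⟩
  · rw [norm_smul, h8n]
    have h1 := lp.norm_apply_le_norm ENNReal.top_ne_zero (r (s j)) i
    have h2 : ‖z j‖ ≤ ‖z j - (r (s j) i - σ (s j))‖ + (‖r (s j) i‖ + ‖σ (s j)‖) := by
      calc ‖z j‖ = ‖(z j - (r (s j) i - σ (s j))) + (r (s j) i - σ (s j))‖ := by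
            rw [sub_add_cancel]
        _ ≤ _ := (norm_add_le _ _).trans (add_le_add_right (norm_sub_le _ _) _)
    have h3 : ε ≤ 1 := min_le_left _ _
    linarith [hz j, hrn (s j), (hs j).1, (hs j).2]
  · simpa only [map_smul] using
      (hbasic.of_abs_norm_sub_le hcpos.le hclose).const_smul h8
  · intro a ha hsum
    have h1 := hlow a ha hsum
    have h2 := abs_le.1 (hclose fun j => (a j : 𝕜))
    have e : ∑ j, (a j : 𝕜) • A (((8 : ℝ)⁻¹ : 𝕜) • z j) =
        ((8 : ℝ)⁻¹ : 𝕜) • ∑ j, (a j : 𝕜) • A (z j) := by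
      rw [Finset.smul_sum]
      refine Finset.sum_congr rfl fun j _ => ?_
      rw [map_smul, smul_comm]
    rw [e, norm_smul, h8n]
    linarith

end
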